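/- Let $m$ be Lebesgue measure on $X=[0,1]$. For $f\in L^1(m)$ let $Vf$ be the infimum of the total variations of the functions $\bar f:[0,1]\to\mathbb R$ with $\bar f=f$ $m$-a.e., let $\mathrm{BV}=\{f\in L^1(m): Vf<\infty\}$, and let $\|f\|_{\mathrm{BV}}=Vf+\|f\|_{L^1(m)}$. For a measurable map $T:X\to X$ with $T_*m\ll m$, the transfer operator $P_T:L^1(m)\to L^1(m)$ is defined by letting $P_Tf$ be the density with respect to $m$ of the image under $T$ of the signed measure $f\,dm$. Let $\mathcal C$ be a class of maps $T:[0,1]\to[0,1]$ such that: (1) There are an integer $r\ge1$ and constants $0<\rho<1$, $M_0>0$, $c>0$ such that for all $f\in\mathrm{BV}$, $\|P_Tf\|_{\mathrm{BV}}\le M_0\|f\|_{\mathrm{BV}}$ for all $T\in\mathcal C$, and $\|P_{S_r}\cdots P_{S_1}f\|_{\mathrm{BV}}\le\rho\|f\|_{\mathrm{BV}}+c\|f\|_{L^1(m)}$ for all $S_1,\dots,S_r\in\mathcal C$ (condition $(D_r)$). Moreover there are $0<\theta<1$ and $K>0$ such that for all $l\ge1$, all $S_1,\dots,S_l\in\mathcal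 C$ and all $f\in\mathrm{BV}$ with $\int f\,dm=0$, $\|P_{S_l}\cdots P_{S_1}f\|_{\mathrm{BV}}\le K\theta^l\|f\|_{\mathrm{BV}}$ (condition (Dec)). (2) and (3) There are $\lambda>1$, $M\ge1$ and an integer $N\ge1$ such that every $T\in\mathcal C$ admits a partition $0=a_0<a_1<\dots<a_k=1$ with $k\le N$ for which, for each $i$, the restriction of $T$ to $(a_{i-1},a_i)$ extends to a $C^2$ map on a neighbourhood of $[a_{i-1},a_i]$, and $|T'|\ge\lambda$, $|T''|\le M$ on $(a_{i-1},a_i)$. Let $(T_n)_{n\ge1}$ be a sequence in $\mathcal C$, and write $T_1^k=T_k\circ\dots\circ T_1$, $T_1^0=\mathrm{id}$. Assume condition (Min): there is $\delta>0$ such that $P_{T_1^n}\mathbf 1\ge\delta$ $m$-a.e. for all $n\ge1$. For $n\ge1$ and $x\in[0,1]$ let $\mathcal E_n(x)=\frac1n\sum_{k=0}^{n-1}\delta_{T_1^kx}$ and $m_n=\frac1n\sum_{k=0}^{n-1}(T_1^k)_*m$. For probability measures $\mu_1,\mu_2$ on $[0,1]$ let $\kappa(\mu_1,\mu_2)=\int_0^1|F_{\mu_1}(s)-F_{\mu_2}(s)|\,ds$,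 where $F_{\mu_i}(s)=\mu_i([0,s])$, be their Kantorovich distance. Then there exist $t_0>0$ and $C>0$ such that for all $t>t_0$ and all $n\ge1$, $$m\left(\kappa(\mathcal E_n,m_n)>\frac t{\sqrt n}\right)\le e^{-Ct^2}.$$ -/

import Mathlib

open MeasureTheory unitInterval

noncomputable section

namespace SeqDyn

/-! The phase space is `I = [0,1]` with its Borel sets; `volume` is Lebesgue measure on it. -/

/-- A finite partition `0 = a₀ < a₁ < ⋯ < a_k = 1` of `[0,1]` into `k` intervals with disjoint
interiors such that, on the interior of each of them, `T` coincides with a map which is `C²` on a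
neighbourhood of the closed interval. (The values of `T` at the finitely many points `aᵢ` are not
restricted.) -/
structure C2Partition (T : I → I) where
  /-- number of intervals -/
  card : ℕ
  /-- end points of the intervals -/
  pt : Fin (card + 1) → ℝ
  pt_strictMono : StrictMono pt
  pt_zero : pt 0 = 0
  pt_last : pt (Fin.last card) = 1
  /-- `C²` extensions of the restrictions of `T` to the open intervals -/
  branch : Fin card → ℝ → ℝ
  branch_contDiff : ∀ i, ∃ U : Set ℝ, IsOpen U ∧ Set.Icc (pt i.castSucc) (pt i.succ) ⊆ U ∧
    ContDiffOn ℝ 2 (branch i) U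
  branch_eq : ∀ i, ∀ x : I, (x : ℝ) ∈ Set.Ioo (pt i.castSucc) (pt i.succ) →
    (T x : ℝ) = branch i x

/-- `𝒞` is a class of piecewise expanding maps of `[0,1]` with `inf |T'| ≥ lam`, `sup |T''| ≤ M`
and `#𝒜_T ≤ N` for all `T ∈ 𝒞`, where `𝒜_T` is the partition into intervals for `T`. -/
def UniformlyPiecewiseExpanding (𝒞 : Set (I → I)) (lam M : ℝ) (N : ℕ) : Prop :=
  ∀ T ∈ 𝒞, ∃ A : C2Partition T, A.card ≤ N ∧
    ∀ i, ∀ x ∈ Set.Ioo (A.pt i.castSucc) (A.pt i.succ),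
      lam ≤ |deriv (A.branch i) x| ∧ |deriv (deriv (A.branch i)) x| ≤ M

/-- The transfer operator: for `f ∈ L¹(m)`, `P_T f` is the Radon-Nikodym derivative with respect
to `m` of the image under `T` of the signed measure `f dm`. -/
def transfer (T : I → I) (f : I → ℝ) : I → ℝ :=
  SignedMeasure.rnDeriv (((volume : Measure I).withDensityᵥ f).map T) volume

/-- `transferProd S l f = P_{S_l} ⋯ P_{S_1} f`. -/
def transferProd (S : ℕ → I → I) : ℕ → (I → ℝ) → (I → ℝ)
  | 0, f => f
  | l + 1, f => transfer (S (l + 1)) (transferProd S l f)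

/-- `V f`: the least total variation of a function on `[0,1]` that is a.e. equal to `f`. -/
def essVar (f : I → ℝ) : ENNReal :=
  ⨅ (g : I → ℝ) (_ : f =ᵐ[volume] g), eVariationOn g Set.univ

/-- Membership in the space `BV ⊆ L¹(m)`. -/
def MemBV (f : I → ℝ) : Prop := Integrable f volume ∧ essVar f < ⊤

/-- The norm `‖f‖_BV = V f + ‖f‖_{L¹}`, with values in `[0,∞]`. -/
def bvNorm (f : I → ℝ) : ENNReal := essVar f + eLpNorm f 1 volume

/-- Condition `(D_r)`: `P_T` is uniformly bounded on `BV` for `T ∈ 𝒞`, and products of `r`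
transfer operators of maps in `𝒞` satisfy a uniform Lasota-Yorke inequality. -/
def ConditionD (r : ℕ) (𝒞 : Set (I → I)) : Prop :=
  ∃ ρ M₀ c : ℝ, 0 < ρ ∧ ρ < 1 ∧ 0 < M₀ ∧ 0 < c ∧
    (∀ T ∈ 𝒞, ∀ f, MemBV f → bvNorm (transfer T f) ≤ ENNReal.ofReal M₀ * bvNorm f) ∧
    (∀ S : ℕ → I → I, (∀ i, 1 ≤ i → i ≤ r → S i ∈ 𝒞) → ∀ f, MemBV f →
      bvNorm (transferProd S r f) ≤
        ENNReal.ofReal ρ * bvNorm f + ENNReal.ofReal c * eLpNorm f 1 volume)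

/-- Condition (Dec): exponential decay in `BV` of products of transfer operators of maps in `𝒞`
on the functions of zero average. -/
def ConditionDec (𝒞 : Set (I → I)) : Prop :=
  ∃ θ K : ℝ, 0 < θ ∧ θ < 1 ∧ 0 < K ∧
    ∀ l : ℕ, 1 ≤ l → ∀ S : ℕ → I → I, (∀ i, 1 ≤ i → i ≤ l → S i ∈ 𝒞) →
      ∀ f, MemBV f → ∫ x, f x = 0 →
        bvNorm (transferProd S l f) ≤ ENNReal.ofReal (K * θ ^ l) * bvNorm f

/-- `orbit T k = T_1^k = T_k ∘ ⋯ ∘ T_1`, with `T_1^0 = id`. -/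
def orbit (T : ℕ → I → I) : ℕ → I → I
  | 0 => id
  | k + 1 => T (k + 1) ∘ orbit T k

/-- Condition (Min): there is `δ > 0` with `P_1^n 1 ≥ δ` a.e. for all `n ≥ 1`. -/
def ConditionMin (T : ℕ → I → I) : Prop :=
  ∃ δ : ℝ, 0 < δ ∧ ∀ n : ℕ, 1 ≤ n → ∀ᵐ x : I, δ ≤ transfer (orbit T n) (fun _ => 1) x

/-- The empirical measure `(1/n) ∑_{k<n} δ_{T_1^k x}`. -/
def empiricalMeasure (T : ℕ → I → I) (n : ℕ) (x : I) : Measure I :=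
  (n : ENNReal)⁻¹ • ∑ k ∈ Finset.range n, Measure.dirac (orbit T k x)

/-- The measure `m_n = (1/n) ∑_{k<n} (T_1^k)_* m`. -/
def meanMeasure (T : ℕ → I → I) (n : ℕ) : Measure I :=
  (n : ENNReal)⁻¹ • ∑ k ∈ Finset.range n, (volume : Measure I).map (orbit T k)

/-- The Kantorovich distance `∫₀¹ |F_μ(t) - F_ν(t)| dt`, where `F_μ(t) = μ([0,t])`. -/
def kantorovich (μ ν : Measure I) : ℝ :=
  ∫ t : I, |μ.real (Set.Iic t) - ν.real (Set.Iic t)|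

end SeqDyn

end

/-! Fix `s` and let `φ_k` be the indicator of `{T_1^k ≤ s}` minus its mean. The σ-algebras
`σ(T_1^k)` decrease in `k`, and on them the transfer operator computes conditional expectations:
`E[f | σ(T_1^k)]` is `(P_1^k f / P_1^k 1) ∘ T_1^k`. Now `P_1^j φ_j` has zero mean and a `BV` norm
bounded uniformly in `j`, so (Dec) makes `P_1^n (∑_{k<n} φ_k)` a geometric sum, bounded uniformly
in `n`, and (Min) turns this into a uniform bound on `E[∑_{k<n} φ_k | σ(T_1^n)]`. Hence
`∑_{k<n} φ_k` is, up to a bounded error, a sum of `n` bounded reverse martingale differences, and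
Azuma's inequality gives Gaussian bounds on its exponential moments, uniformly in `s`. By Jensen's
inequality they pass to `∫ |∑_{k<n} φ_k| ds = n κ(ℰ_n, m_n)`, to which Chernoff's bound applies.

The uniform `BV` bound on the densities `P_1^n 1` comes from telescoping: `P_{j+1} 1 - 1` has zero
mean, so moving the starting time by one changes the density at time `n` by `O(θ^n)`. -/

namespace SeqDyn

open scoped NNReal

section Concentration
open ProbabilityTheory Filter

variable {Ω : Type*} {m mΩ : MeasurableSpace Ω} {μ : Measure Ω}

lemma hasCondSubgaussianMGF_of_abs_le [StandardBorelSpace Ω] [IsFiniteMeasure μ] (hm : m ≤ mΩ)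
    {Y : Ω → ℝ} (hY : Measurable Y) {C : ℝ≥0} (hYC : ∀ᵐ ω ∂μ, |Y ω| ≤ C) (hY0 : μ[Y | m] =ᵐ[μ] 0) :
    HasCondSubgaussianMGF m hm Y (C ^ 2) μ := by
  have hmem : ∀ᵐ ω ∂μ, Y ω ∈ Set.Icc (-(C : ℝ)) C := hYC.mono fun ω h => abs_le.1 h
  have hint : Integrable Y μ := .of_bound hY.aestronglyMeasurable C hYC
  have hmean : ∀ᵐ ω' ∂μ.trim hm, ∫ ω, Y ω ∂condExpKernel μ m ω' = 0 :=
    (condExp_ae_eq_trim_integral_condExpKernel hm hint).symm.trans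
      ((stronglyMeasurable_condExp.ae_eq_trim_iff hm stronglyMeasurable_zero).2 hY0)
  rw [← condExpKernel_comp_trim (μ := μ) hm] at hmem
  refine ⟨fun t => integrable_exp_mul_of_mem_Icc hY.aemeasurable hmem, ?_⟩
  filter_upwards [hmean, Measure.ae_ae_of_ae_comp hmem] with ω' h0 hC t
  have h := (hasSubgaussianMGF_of_mem_Icc_of_integral_eq_zero hY.aemeasurable hC h0).mgf_le t
  simpa [← two_mul] using h

lemma hasSubgaussianMGF_sum_of_condExp_succ_eq_zero [StandardBorelSpace Ω]
    [IsZeroOrProbabilityMeasure μ] {𝒢 : ℕ → MeasurableSpace Ω} (h𝒢 : Antitone 𝒢)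
    (hle : ∀ k, 𝒢 k ≤ mΩ) {Y : ℕ → Ω → ℝ} (hY : ∀ k, Measurable[𝒢 k] (Y k)) {C : ℝ≥0}
    (hYC : ∀ k, ∀ᵐ ω ∂μ, |Y k ω| ≤ C) (hY0 : ∀ k, μ[Y k | 𝒢 (k + 1)] =ᵐ[μ] 0) (n : ℕ) :
    HasSubgaussianMGF (fun ω => ∑ k ∈ Finset.range n, Y k ω) (n * C ^ 2) μ := by
  induction n generalizing Y 𝒢 with
  | zero => simp
  | succ n ih =>
    have htail : HasSubgaussianMGF (fun ω => ∑ k ∈ Finset.range n, Y (k + 1) ω) (n * C ^ 2) μ :=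
      ih (fun i j hij => h𝒢 (by omega)) (fun k => hle _) (fun k => hY _) (fun k => hYC _)
        fun k => hY0 _
    have htail_meas : Measurable[𝒢 1] fun ω => ∑ k ∈ Finset.range n, Y (k + 1) ω :=
      Finset.measurable_fun_sum _ fun k _ => (hY _).mono (h𝒢 (by omega)) le_rfl
    have hhead := hasCondSubgaussianMGF_of_abs_le (hle 1) ((hY 0).mono (hle 0) le_rfl)
      (hYC 0) (hY0 0)
    convert HasSubgaussianMGF.add_of_hasCondSubgaussianMGF (hle 1)
      (htail.trim (hle 1) htail_meas) hhead using 1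
    · ext ω
      simp only [Finset.sum_range_succ', Pi.add_apply]
    · push_cast
      ring

lemma mgf_le_exp_mul_mgf_of_abs_sub_le {X Z : Ω → ℝ} {L t : ℝ}
    (h : ∀ᵐ ω ∂μ, |X ω - Z ω| ≤ L) (hZ : Integrable (fun ω => Real.exp (t * Z ω)) μ) :
    mgf X μ t ≤ Real.exp (|t| * L) * mgf Z μ t := by
  rw [mgf, mgf, ← integral_const_mul]
  refine integral_mono_of_nonneg (.of_forall fun ω => (Real.exp_pos _).le) (hZ.const_mul _)
    (h.mono fun ω hω => ?_)
  have hle : t * (X ω - Z ω) ≤ |t| * L := (le_abs_self _).trans <| by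
    rw [abs_mul]
    gcongr
  simp only [← Real.exp_add]
  gcongr
  linarith

section ReverseMartingale

variable {𝒢 : ℕ → MeasurableSpace Ω} {φ : ℕ → Ω → ℝ}

/-- The `k`-th reverse martingale difference in the martingale–coboundary decomposition of the
partial sums of `φ`: the corrector is the conditional expectation of the past sum
`∑_{j<k} φ j` given the present `𝒢 k`. -/
noncomputable def reverseMartingaleDiff (μ : Measure Ω) (𝒢 : ℕ → MeasurableSpace Ω)
    (φ : ℕ → Ω → ℝ) (k : ℕ) : Ω → ℝ :=
  φ k + (μ[∑ j ∈ Finset.range k, φ j | 𝒢 k] - μ[∑ j ∈ Finset.range (k + 1), φ j | 𝒢 (k + 1)])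

lemma sum_reverseMartingaleDiff (μ : Measure Ω) (𝒢 : ℕ → MeasurableSpace Ω) (φ : ℕ → Ω → ℝ)
    (n : ℕ) : ∑ k ∈ Finset.range n, reverseMartingaleDiff μ 𝒢 φ k =
      ∑ k ∈ Finset.range n, φ k - μ[∑ k ∈ Finset.range n, φ k | 𝒢 n] := by
  simp only [reverseMartingaleDiff, Finset.sum_add_distrib]
  rw [Finset.sum_range_sub' fun k => μ[∑ j ∈ Finset.range k, φ j | 𝒢 k]]
  simp [sub_eq_add_neg]

lemma measurable_reverseMartingaleDiff (h𝒢 : Antitone 𝒢) (hφ : ∀ k, Measurable[𝒢 k] (φ k))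
    (k : ℕ) : Measurable[𝒢 k] (reverseMartingaleDiff μ 𝒢 φ k) :=
  (hφ k).add (stronglyMeasurable_condExp.measurable.sub
    (stronglyMeasurable_condExp.measurable.mono (h𝒢 k.le_succ) le_rfl))

lemma condExp_reverseMartingaleDiff [IsFiniteMeasure μ] (h𝒢 : Antitone 𝒢) (hle : ∀ k, 𝒢 k ≤ mΩ)
    (hφ : ∀ k, Measurable[𝒢 k] (φ k)) (hint : ∀ k, Integrable (φ k) μ) (k : ℕ) :
    μ[reverseMartingaleDiff μ 𝒢 φ k | 𝒢 (k + 1)] =ᵐ[μ] 0 := by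
  set S : ℕ → Ω → ℝ := fun k => ∑ j ∈ Finset.range k, φ j with hS
  have hS_int : ∀ k, Integrable (S k) μ := fun k => integrable_finsetSum' _ fun j _ => hint j
  have hpresent : φ k + μ[S k | 𝒢 k] =ᵐ[μ] μ[S (k + 1) | 𝒢 k] := by
    have hself : μ[φ k | 𝒢 k] = φ k :=
      condExp_of_stronglyMeasurable (hle k) (hφ k).stronglyMeasurable (hint k)
    have h := condExp_add (hint k) (hS_int k) (𝒢 k)
    rw [hself] at h
    simpa only [hS, Finset.sum_range_succ_comm] using h.symm
  have htower : μ[φ k + μ[S k | 𝒢 k] | 𝒢 (k + 1)] =ᵐ[μ] μ[S (k + 1) | 𝒢 (k + 1)] :=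
    (condExp_congr_ae hpresent).trans (condExp_condExp_of_le (h𝒢 k.le_succ) (hle k))
  have hself : μ[μ[S (k + 1) | 𝒢 (k + 1)] | 𝒢 (k + 1)] = μ[S (k + 1) | 𝒢 (k + 1)] :=
    condExp_of_stronglyMeasurable (hle _) stronglyMeasurable_condExp integrable_condExp
  have hsub : μ[φ k + μ[S k | 𝒢 k] - μ[S (k + 1) | 𝒢 (k + 1)] | 𝒢 (k + 1)] =ᵐ[μ] _ :=
    condExp_sub ((hint k).add integrable_condExp) integrable_condExp _
  rw [reverseMartingaleDiff, ← add_sub_assoc]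
  filter_upwards [hsub, htower] with ω h1 h2
  rw [h1, Pi.sub_apply, h2, hself, sub_self, Pi.zero_apply]

lemma mgf_sum_le_of_abs_condExp_le [StandardBorelSpace Ω] [IsProbabilityMeasure μ]
    (h𝒢 : Antitone 𝒢) (hle : ∀ k, 𝒢 k ≤ mΩ) (hφ : ∀ k, Measurable[𝒢 k] (φ k)) {b L : ℝ≥0}
    (hφb : ∀ k, ∀ᵐ ω ∂μ, |φ k ω| ≤ b)
    (hL : ∀ k, ∀ᵐ ω ∂μ, |(μ[∑ j ∈ Finset.range k, φ j | 𝒢 k]) ω| ≤ L) (n : ℕ) (t : ℝ) :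
    mgf (∑ k ∈ Finset.range n, φ k) μ t ≤
      Real.exp (|t| * L) * Real.exp (n * (b + 2 * L) ^ 2 * t ^ 2 / 2) := by
  set Y := reverseMartingaleDiff μ 𝒢 φ
  have hint : ∀ k, Integrable (φ k) μ := fun k =>
    .of_bound ((hφ k).mono (hle k) le_rfl).aestronglyMeasurable b (hφb k)
  have hYC : ∀ k, ∀ᵐ ω ∂μ, |Y k ω| ≤ (b + 2 * L : ℝ≥0) := fun k => by
    filter_upwards [hφb k, hL k, hL (k + 1)] with ω h1 h2 h3
    push_cast
    calc |Y k ω| ≤ _ := (abs_add_le _ _).trans (add_le_add_right (abs_sub _ _) _)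
      _ ≤ b + (L + L) := by gcongr
      _ = b + 2 * L := by ring
  have hY := hasSubgaussianMGF_sum_of_condExp_succ_eq_zero h𝒢 hle
    (measurable_reverseMartingaleDiff h𝒢 hφ) hYC
    (condExp_reverseMartingaleDiff h𝒢 hle hφ hint) n
  have hclose : ∀ᵐ ω ∂μ,
      |(∑ k ∈ Finset.range n, φ k) ω - ∑ k ∈ Finset.range n, Y k ω| ≤ L := by
    filter_upwards [hL n] with ω hω
    rwa [← Finset.sum_apply, sum_reverseMartingaleDiff, Pi.sub_apply, sub_sub_cancel]
  refine (mgf_le_exp_mul_mgf_of_abs_sub_le hclose (hY.integrable_exp_mul t)).trans ?_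
  gcongr
  simpa using hY.mgf_le t

end ReverseMartingale

section Average

variable {S : Type*} {mS : MeasurableSpace S} {ν : Measure S}

lemma mgf_abs_le_mgf_add_mgf_neg {X : Ω → ℝ} {t : ℝ}
    (h : Integrable (fun ω => Real.exp (t * X ω)) μ)
    (h' : Integrable (fun ω => Real.exp (-t * X ω)) μ) :
    mgf (fun ω => |X ω|) μ t ≤ mgf X μ t + mgf X μ (-t) := by
  rw [mgf, mgf, mgf, ← integral_add h h']
  refine integral_mono_of_nonneg (.of_forall fun ω => (Real.exp_pos _).le) (h.add h')
    (.of_forall fun ω => ?_)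
  rcases abs_choice (X ω) with hX | hX <;> simp [hX, Real.exp_nonneg]

lemma mgf_integral_le_integral_mgf [SFinite μ] [IsProbabilityMeasure ν] {F : Ω → S → ℝ} {t : ℝ}
    (hF : Integrable (Function.uncurry F) (μ.prod ν))
    (hexp : Integrable (Function.uncurry fun ω s => Real.exp (t * F ω s)) (μ.prod ν)) :
    mgf (fun ω => ∫ s, F ω s ∂ν) μ t ≤ ∫ s, mgf (F · s) μ t ∂ν := by
  simp only [mgf]
  rw [← integral_integral_swap hexp]
  refine integral_mono_of_nonneg (.of_forall fun ω => (Real.exp_pos _).le) hexp.integral_prod_left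
    ?_
  filter_upwards [hF.prod_right_ae, hexp.prod_right_ae] with ω hω hω'
  simp only [← integral_const_mul]
  exact convexOn_exp.map_integral_le Real.continuous_exp.continuousOn isClosed_univ
    (.of_forall fun _ => Set.mem_univ _) (hω.const_mul t) hω'

lemma mgf_integral_abs_le [IsProbabilityMeasure μ] [IsProbabilityMeasure ν] {F : Ω → S → ℝ}
    (hF : Measurable (Function.uncurry F)) {D : ℝ} (hD : ∀ ω s, |F ω s| ≤ D) {t b : ℝ}
    (hb : ∀ s, mgf (F · s) μ t ≤ b) (hb' : ∀ s, mgf (F · s) μ (-t) ≤ b) :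
    mgf (fun ω => ∫ s, |F ω s| ∂ν) μ t ≤ 2 * b := by
  have habs : ∀ z : Ω × S, |Function.uncurry F z| ∈ Set.Icc 0 D := fun z =>
    ⟨abs_nonneg _, hD _ _⟩
  have hexp : Integrable (Function.uncurry fun ω s => Real.exp (t * |F ω s|)) (μ.prod ν) :=
    integrable_exp_mul_of_mem_Icc hF.abs.aemeasurable (.of_forall habs)
  have hexp_s : ∀ s t, Integrable (fun ω => Real.exp (t * F ω s)) μ := fun s t =>
    integrable_exp_mul_of_mem_Icc (hF.comp measurable_prodMk_right).aemeasurable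
      (.of_forall fun ω => abs_le.1 (hD ω s))
  calc mgf (fun ω => ∫ s, |F ω s| ∂ν) μ t
      ≤ ∫ s, mgf (fun ω => |F ω s|) μ t ∂ν :=
        mgf_integral_le_integral_mgf (.of_mem_Icc 0 D hF.abs.aemeasurable (.of_forall habs)) hexp
    _ ≤ ∫ _, 2 * b ∂ν := by
      refine integral_mono hexp.integral_prod_right (integrable_const _) fun s => ?_
      have := mgf_abs_le_mgf_add_mgf_neg (hexp_s s t) (hexp_s s (-t))
      linarith [hb s, hb' s]
    _ = 2 * b := by simp

end Average

lemma measureReal_sqrt_mul_lt_le [IsFiniteMeasure μ] {X : Ω → ℝ} {L v : ℝ} (hL : 0 ≤ L) (hv : 0 < v)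
    {n : ℕ} (hn : 1 ≤ n) (hX : ∀ t, Integrable (fun ω => Real.exp (t * X ω)) μ)
    (hmgf : ∀ t, 0 ≤ t → mgf X μ t ≤ 2 * (Real.exp (t * L) * Real.exp (n * v * t ^ 2 / 2)))
    {t : ℝ} (ht : 4 * (L + v) + 1 < t) :
    μ.real {ω | √n * t < X ω} ≤ Real.exp (-(t ^ 2 / (4 * v))) := by
  have hn1 : 1 ≤ √(n : ℝ) := Real.one_le_sqrt.2 (by exact_mod_cast hn)
  have hn0 : √(n : ℝ) ≠ 0 := by positivity
  have ht0 : 0 < t := by linarith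
  set a := t / (√n * v) with ha
  have ha0 : 0 ≤ a := by positivity
  have hlinear : a * L ≤ t * L / v := by
    rw [ha, div_mul_eq_mul_div]
    gcongr
    exact le_mul_of_one_le_left hv.le hn1
  have hquadratic : n * v * a ^ 2 / 2 = t ^ 2 / (2 * v) := by
    rw [ha, div_pow, mul_pow, Real.sq_sqrt n.cast_nonneg]
    field_simp
  have hthreshold : -a * (√n * t) = -(t ^ 2 / v) := by
    rw [ha]
    field_simp
  have hlarge : 1 + t * L / v - t ^ 2 / (2 * v) ≤ -(t ^ 2 / (4 * v)) := by
    have : 4 * v + 4 * (t * L) ≤ t ^ 2 := by nlinarith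
    field_simp
    linarith
  have htwo : (2 : ℝ) ≤ Real.exp 1 := by linarith [Real.add_one_le_exp (1 : ℝ)]
  calc μ.real {ω | √n * t < X ω}
      ≤ μ.real {ω | √n * t ≤ X ω} := measureReal_mono (Set.ofPred_subset_ofPred.2 fun ω => le_of_lt)
    _ ≤ Real.exp (-a * (√n * t)) * mgf X μ a := measure_ge_le_exp_mul_mgf _ ha0 (hX a)
    _ ≤ Real.exp (-a * (√n * t)) *
        (Real.exp 1 * (Real.exp (t * L / v) * Real.exp (n * v * a ^ 2 / 2))) := by
      gcongr
      exact (hmgf a ha0).trans (by gcongr)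
    _ = Real.exp (1 + t * L / v - t ^ 2 / (2 * v)) := by
      rw [hthreshold, hquadratic, ← Real.exp_add, ← Real.exp_add, ← Real.exp_add]
      congr 1
      field_simp
      ring
    _ ≤ _ := Real.exp_le_exp.2 hlarge

end Concentration

section Nonsingularity

lemma injOn_of_deriv_ne_zero {f : ℝ → ℝ} {s : Set ℝ} [hs : s.OrdConnected]
    (hf : ContinuousOn f s) (h : ∀ x ∈ s, deriv f x ≠ 0) : Set.InjOn f s := by
  have hne : ∀ x ∈ s, ∀ y ∈ s, x < y → f x ≠ f y := fun x hx y hy hxy heq => by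
    obtain ⟨z, hz, hz0⟩ := exists_deriv_eq_zero hxy (hf.mono (hs.out hx hy)) heq
    exact h z (hs.out hx hy (Set.Ioo_subset_Icc_self hz)) hz0
  intro x hx y hy heq
  rcases lt_trichotomy x y with hxy | hxy | hyx
  exacts [(hne x hx y hy hxy heq).elim, hxy, (hne y hy x hx hyx heq.symm).elim]

lemma volume_inter_preimage_eq_zero {f : ℝ → ℝ} {s t : Set ℝ} [s.OrdConnected]
    (hm : MeasurableSet (s ∩ f ⁻¹' t)) (hf : ∀ x ∈ s, DifferentiableAt ℝ f x)
    (h : ∀ x ∈ s, deriv f x ≠ 0) (ht : volume t = 0) : volume (s ∩ f ⁻¹' t) = 0 := by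
  have hinj : Set.InjOn f s :=
    injOn_of_deriv_ne_zero (fun x hx => (hf x hx).continuousAt.continuousWithinAt) h
  have himage : volume (f '' (s ∩ f ⁻¹' t)) = 0 :=
    measure_mono_null (Set.image_subset_iff.2 Set.inter_subset_right) ht
  have hchange := lintegral_image_eq_lintegral_abs_deriv_mul hm
    (fun x hx => (hf x hx.1).hasDerivAt.hasDerivWithinAt) (hinj.mono Set.inter_subset_left)
    fun _ => 1
  rw [setLIntegral_measure_zero _ _ himage, eq_comm,
    lintegral_eq_zero_iff (by have := measurable_deriv f; fun_prop)] at hchange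
  rw [← Measure.restrict_eq_zero, ← ae_eq_bot, ← Filter.empty_mem_iff_bot]
  filter_upwards [hchange, ae_restrict_mem hm] with x hx hxs
  simp only [mul_one, Pi.zero_apply, ENNReal.ofReal_eq_zero] at hx
  exact h x hxs.1 (abs_nonpos_iff.1 hx)

namespace C2Partition

variable {T : I → I} (A : C2Partition T)

lemma mem_range_pt_or_exists_mem_Ioo (x : I) :
    (x : ℝ) ∈ Set.range A.pt ∨
      ∃ i : Fin A.card, (x : ℝ) ∈ Set.Ioo (A.pt i.castSucc) (A.pt i.succ) := by
  refine or_iff_not_imp_left.2 fun hx => ?_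
  obtain ⟨i, hi, hmax⟩ := (Finset.univ.filter fun i => A.pt i ≤ x).exists_max_image id
    ⟨0, by simp [A.pt_zero, x.2.1]⟩
  simp only [Finset.mem_filter, Finset.mem_univ, true_and, id] at hi hmax
  have hlast : i ≠ Fin.last _ := by
    rintro rfl
    rw [A.pt_last] at hi
    exact hx ⟨Fin.last _, A.pt_last.trans (le_antisymm hi x.2.2)⟩
  obtain ⟨j, rfl⟩ := Fin.exists_castSucc_eq.2 hlast
  refine ⟨j, lt_of_le_of_ne hi fun h => hx ⟨_, h⟩, ?_⟩
  by_contra! h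
  exact absurd (hmax _ h) (not_le.2 Fin.castSucc_lt_succ)

lemma finite_preimage_range_pt : (Subtype.val ⁻¹' Set.range A.pt : Set I).Finite :=
  (Set.finite_range _).preimage Subtype.val_injective.injOn

lemma differentiableAt_branch (i : Fin A.card) {x : ℝ}
    (hx : x ∈ Set.Ioo (A.pt i.castSucc) (A.pt i.succ)) : DifferentiableAt ℝ (A.branch i) x := by
  obtain ⟨U, hU, hsub, hd⟩ := A.branch_contDiff i
  exact (hd.differentiableOn two_ne_zero).differentiableAt
    (hU.mem_nhds (hsub (Set.Ioo_subset_Icc_self hx)))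

/-- The points of the `i`-th open interval that the `i`-th branch maps into `s`: the part of
`T⁻¹ s` in that interval. It is a set of reals, as the branches are functions on `ℝ`. -/
def branchPreimage (i : Fin A.card) (s : Set I) : Set ℝ :=
  Set.Ioo (A.pt i.castSucc) (A.pt i.succ) ∩ A.branch i ⁻¹' (Subtype.val '' s)

lemma measurableSet_branchPreimage (i : Fin A.card) {s : Set I} (hs : MeasurableSet s) :
    MeasurableSet (A.branchPreimage i s) := by
  classical
  have hcont : ContinuousOn (A.branch i) (Set.Ioo (A.pt i.castSucc) (A.pt i.succ)) := fun x hx =>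
    (A.differentiableAt_branch i hx).continuousAt.continuousWithinAt
  have hmeas : Measurable ((Set.Ioo (A.pt i.castSucc) (A.pt i.succ)).piecewise (A.branch i) 0) :=
    hcont.measurable_piecewise continuousOn_const measurableSet_Ioo
  have hs' : MeasurableSet (Subtype.val '' s : Set ℝ) :=
    unitInterval.measurableEmbedding_coe.measurableSet_image.2 hs
  suffices A.branchPreimage i s = Set.Ioo (A.pt i.castSucc) (A.pt i.succ) ∩
      (Set.Ioo (A.pt i.castSucc) (A.pt i.succ)).piecewise (A.branch i) 0 ⁻¹' (Subtype.val '' s) from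
    this ▸ measurableSet_Ioo.inter (hmeas hs')
  ext x
  refine and_congr_right fun hx => ?_
  rw [Set.mem_preimage, Set.mem_preimage, Set.piecewise_eq_of_mem _ _ _ hx]

lemma preimage_eq_union_iUnion_branchPreimage (s : Set I) :
    T ⁻¹' s = (T ⁻¹' s ∩ Subtype.val ⁻¹' Set.range A.pt) ∪
      ⋃ i, Subtype.val ⁻¹' A.branchPreimage i s := by
  have hbranch : ∀ i (x : I), (x : ℝ) ∈ A.branchPreimage i s ↔
      (x : ℝ) ∈ Set.Ioo (A.pt i.castSucc) (A.pt i.succ) ∧ T x ∈ s := fun i x =>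
    and_congr_right fun hx => by
      rw [Set.mem_preimage, ← A.branch_eq i x hx, Subtype.val_injective.mem_set_image]
  ext x
  simp only [Set.mem_union, Set.mem_inter_iff, Set.mem_iUnion, Set.mem_preimage (f := Subtype.val),
    hbranch]
  constructor
  · intro hx
    rcases A.mem_range_pt_or_exists_mem_Ioo x with hpt | ⟨i, hi⟩
    exacts [Or.inl ⟨hx, hpt⟩, Or.inr ⟨i, hi, hx⟩]
  · rintro (⟨hx, -⟩ | ⟨i, -, hx⟩) <;> exact hx

lemma measurable (A : C2Partition T) : Measurable T := fun s hs => by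
  rw [A.preimage_eq_union_iUnion_branchPreimage s]
  exact (A.finite_preimage_range_pt.subset Set.inter_subset_right).measurableSet.union
    (.iUnion fun i => measurable_subtype_coe (A.measurableSet_branchPreimage i hs))

lemma quasiMeasurePreserving
    (h : ∀ i, ∀ x ∈ Set.Ioo (A.pt i.castSucc) (A.pt i.succ), deriv (A.branch i) x ≠ 0) :
    Measure.QuasiMeasurePreserving T volume volume := by
  refine ⟨A.measurable, Measure.AbsolutelyContinuous.mk fun s hs hs0 => ?_⟩
  rw [Measure.map_apply A.measurable hs, A.preimage_eq_union_iUnion_branchPreimage s]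
  refine measure_union_null
    ((A.finite_preimage_range_pt.subset Set.inter_subset_right).measure_zero _)
    (measure_iUnion_null fun i => ?_)
  rw [unitInterval.volume_apply] at hs0 ⊢
  exact measure_mono_null (Set.image_preimage_subset _ _) (volume_inter_preimage_eq_zero
    (A.measurableSet_branchPreimage i hs) (fun x => A.differentiableAt_branch i) (h i) hs0)

end C2Partition

lemma UniformlyPiecewiseExpanding.quasiMeasurePreserving {𝒞 : Set (I → I)} {lam M : ℝ} {N : ℕ}
    (h : UniformlyPiecewiseExpanding 𝒞 lam M N) (hlam : 0 < lam) :
    ∀ T ∈ 𝒞, Measure.QuasiMeasurePreserving T volume volume := fun T hT => by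
  obtain ⟨A, -, hA⟩ := h T hT
  exact A.quasiMeasurePreserving fun i x hx =>
    abs_pos.1 (hlam.trans_le (hA i x hx).1)

end Nonsingularity

section Transfer

variable {T : I → I} {f g : I → ℝ}

lemma integrable_transfer (T : I → I) (f : I → ℝ) : Integrable (transfer T f) volume :=
  SignedMeasure.integrable_rnDeriv _ _

lemma setIntegral_transfer (hT : Measure.QuasiMeasurePreserving T volume volume)
    (hf : Integrable f volume) {s : Set I} (hs : MeasurableSet s) :
    ∫ x in s, transfer T f x = ∫ x in T ⁻¹' s, f x := by
  have hac : ((volume : Measure I).withDensityᵥ f).map T ≪ᵥ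
      (volume : Measure I).toENNRealVectorMeasure := by
    refine VectorMeasure.AbsolutelyContinuous.mk fun t ht h0 => ?_
    rw [Measure.toENNRealVectorMeasure_apply_measurable ht] at h0
    rw [VectorMeasure.map_apply _ hT.measurable ht, withDensityᵥ_apply hf (hT.measurable ht)]
    exact setIntegral_measure_zero _ (hT.preimage_null h0)
  rw [← withDensityᵥ_apply (integrable_transfer T f) hs, transfer,
    SignedMeasure.withDensityᵥ_rnDeriv_eq _ _ hac, VectorMeasure.map_apply _ hT.measurable hs,
    withDensityᵥ_apply hf (hT.measurable hs)]

lemma integral_transfer (hT : Measure.QuasiMeasurePreserving T volume volume)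
    (hf : Integrable f volume) : ∫ x, transfer T f x = ∫ x, f x := by
  simpa using setIntegral_transfer hT hf MeasurableSet.univ

lemma transfer_ae_eq_of_setIntegral_eq (hT : Measure.QuasiMeasurePreserving T volume volume)
    (hf : Integrable f volume) (hg : Integrable g volume)
    (h : ∀ s, MeasurableSet s → ∫ x in T ⁻¹' s, f x = ∫ x in s, g x) :
    transfer T f =ᵐ[volume] g :=
  (integrable_transfer T f).ae_eq_of_forall_setIntegral_eq _ _ hg fun s hs _ => by
    rw [setIntegral_transfer hT hf hs, h s hs]

lemma transfer_congr_ae (hT : Measure.QuasiMeasurePreserving T volume volume)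
    (hg : Integrable g volume) (h : f =ᵐ[volume] g) : transfer T f =ᵐ[volume] transfer T g :=
  transfer_ae_eq_of_setIntegral_eq hT (hg.congr h.symm) (integrable_transfer T g) fun s hs => by
    rw [setIntegral_transfer hT hg hs, integral_congr_ae (ae_restrict_of_ae h)]

lemma transfer_id (hf : Integrable f volume) : transfer id f =ᵐ[volume] f :=
  transfer_ae_eq_of_setIntegral_eq (.id volume) hf hf fun _ _ => rfl

lemma transfer_comp {S : I → I} (hS : Measure.QuasiMeasurePreserving S volume volume)
    (hT : Measure.QuasiMeasurePreserving T volume volume) (hf : Integrable f volume) :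
    transfer (S ∘ T) f =ᵐ[volume] transfer S (transfer T f) :=
  transfer_ae_eq_of_setIntegral_eq (hS.comp hT) hf (integrable_transfer S _) fun s hs => by
    rw [setIntegral_transfer hS (integrable_transfer T f) hs,
      setIntegral_transfer hT hf (hS.measurable hs), Set.preimage_comp]

lemma transfer_sub (hT : Measure.QuasiMeasurePreserving T volume volume)
    (hf : Integrable f volume) (hg : Integrable g volume) :
    transfer T (f - g) =ᵐ[volume] transfer T f - transfer T g :=
  transfer_ae_eq_of_setIntegral_eq hT (hf.sub hg)
    ((integrable_transfer T f).sub (integrable_transfer T g)) fun s hs => by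
    simp only [Pi.sub_apply]
    rw [integral_sub hf.integrableOn hg.integrableOn,
      integral_sub (integrable_transfer T f).integrableOn (integrable_transfer T g).integrableOn,
      setIntegral_transfer hT hf hs, setIntegral_transfer hT hg hs]

lemma transfer_finsetSum (hT : Measure.QuasiMeasurePreserving T volume volume) {ι : Type*}
    (u : Finset ι) {φ : ι → I → ℝ} (hφ : ∀ i ∈ u, Integrable (φ i) volume) :
    transfer T (∑ i ∈ u, φ i) =ᵐ[volume] ∑ i ∈ u, transfer T (φ i) :=
  transfer_ae_eq_of_setIntegral_eq hT (integrable_finsetSum' u hφ)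
    (integrable_finsetSum' u fun i _ => integrable_transfer T (φ i)) fun s hs => by
    simp only [Finset.sum_apply]
    rw [integral_finsetSum u fun i hi => (hφ i hi).integrableOn,
      integral_finsetSum u fun i _ => (integrable_transfer T (φ i)).integrableOn]
    exact Finset.sum_congr rfl fun i hi => (setIntegral_transfer hT (hφ i hi) hs).symm

lemma transfer_indicator_preimage_sub_const (hT : Measure.QuasiMeasurePreserving T volume volume)
    {A : Set I} (hA : MeasurableSet A) (c : ℝ) :
    transfer T (fun x => (T ⁻¹' A).indicator 1 x - c) =ᵐ[volume]
      fun x => (A.indicator 1 x - c) * transfer T (fun _ => 1) x := by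
  have hone : Integrable (fun _ : I => (1 : ℝ)) volume := integrable_const 1
  have hpre : Integrable ((T ⁻¹' A).indicator (fun _ => (1 : ℝ))) volume :=
    hone.indicator (hT.measurable hA)
  set p := transfer T fun _ => 1
  have hp_int : Integrable p volume := integrable_transfer T _
  have hmul : (fun x => (A.indicator 1 x - c) * p x) = fun x => A.indicator p x - c * p x := by
    ext x
    by_cases hx : x ∈ A <;> simp [hx, sub_mul]
  rw [hmul]
  refine transfer_ae_eq_of_setIntegral_eq hT (hpre.sub (integrable_const c))
    ((hp_int.indicator hA).sub (hp_int.const_mul c)) fun s hs => ?_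
  have hind : ∫ x in s, A.indicator p x = ∫ x in T ⁻¹' s, (T ⁻¹' A).indicator (fun _ => 1) x := by
    rw [setIntegral_indicator hA, setIntegral_indicator (hT.measurable hA), ← Set.preimage_inter,
      setIntegral_transfer hT hone (hs.inter hA)]
  have hconst : ∫ x in s, c * p x = ∫ _ in T ⁻¹' s, c := by
    rw [integral_const_mul, setIntegral_transfer hT hone hs, ← integral_const_mul, mul_one]
  rw [integral_sub (hp_int.indicator hA).integrableOn (hp_int.const_mul c).integrableOn, hind,
    hconst, ← integral_sub hpre.integrableOn (integrable_const c)]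
  rfl

lemma condExp_comap_le_const_of_transfer_le (hT : Measure.QuasiMeasurePreserving T volume volume)
    (hf : Integrable f volume) {L : ℝ}
    (h : ∀ᵐ x, transfer T f x ≤ L * transfer T (fun _ => 1) x) :
    ∀ᵐ x, (volume[f | MeasurableSpace.comap T inferInstance]) x ≤ L := by
  have hm : MeasurableSpace.comap T inferInstance ≤ _ := hT.measurable.comap_le
  refine ae_le_of_ae_le_trim (hm := hm) (f₂ := fun _ => L) (ae_le_of_forall_setIntegral_le
    (integrable_condExp.trim hm stronglyMeasurable_condExp) (integrable_const L) ?_)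
  rintro _ ⟨s, hs, rfl⟩ -
  have hs' : MeasurableSet[MeasurableSpace.comap T inferInstance] (T ⁻¹' s) := ⟨s, hs, rfl⟩
  rw [← setIntegral_trim hm stronglyMeasurable_condExp hs',
    ← setIntegral_trim hm stronglyMeasurable_const hs']
  calc ∫ x in T ⁻¹' s, (volume[f | MeasurableSpace.comap T inferInstance]) x
      = ∫ x in s, transfer T f x := by
        rw [setIntegral_condExp hm hf hs', setIntegral_transfer hT hf hs]
    _ ≤ ∫ x in s, L * transfer T (fun _ => 1) x :=
      setIntegral_mono_ae (integrable_transfer T f).integrableOn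
        ((integrable_transfer T _).const_mul L).integrableOn h
    _ = ∫ _ in T ⁻¹' s, L := by
      rw [integral_const_mul, setIntegral_transfer hT (integrable_const 1) hs,
        ← integral_const_mul, mul_one]

lemma abs_condExp_comap_le_of_abs_transfer_le
    (hT : Measure.QuasiMeasurePreserving T volume volume) (hf : Integrable f volume) {L : ℝ}
    (h : ∀ᵐ x, |transfer T f x| ≤ L * transfer T (fun _ => 1) x) :
    ∀ᵐ x, |(volume[f | MeasurableSpace.comap T inferInstance]) x| ≤ L := by
  have hneg : transfer T (-f) =ᵐ[volume] -transfer T f :=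
    transfer_ae_eq_of_setIntegral_eq hT hf.neg (integrable_transfer T f).neg fun s hs => by
      simp only [Pi.neg_apply, integral_neg, setIntegral_transfer hT hf hs]
  have hupper := condExp_comap_le_const_of_transfer_le hT hf
    (h.mono fun x hx => (le_abs_self _).trans hx)
  have hlower := condExp_comap_le_const_of_transfer_le hT hf.neg (L := L) <| by
    filter_upwards [h, hneg] with x hx hxn
    exact hxn.le.trans ((neg_le_abs _).trans hx)
  filter_upwards [hupper, hlower, condExp_neg f (MeasurableSpace.comap T inferInstance)]
    with x h1 h2 h3
  rw [h3, Pi.neg_apply] at h2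
  exact abs_le.2 ⟨by linarith, h1⟩

end Transfer

section Orbit

variable {T : ℕ → I → I} {f : I → ℝ}

lemma orbit_add (T : ℕ → I → I) (j l : ℕ) :
    orbit T (j + l) = orbit (fun i => T (j + i)) l ∘ orbit T j := by
  induction l with
  | zero => rfl
  | succ l ih =>
    rw [← add_assoc, orbit, ih]
    rfl

lemma antitone_comap_orbit (hT : ∀ n, 1 ≤ n → Measurable (T n)) :
    Antitone fun k => MeasurableSpace.comap (orbit T k) inferInstance :=
  antitone_nat_of_succ_le fun k => by
    rw [orbit, ← MeasurableSpace.comap_comp]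
    exact MeasurableSpace.comap_mono (hT (k + 1) k.succ_pos).comap_le

lemma quasiMeasurePreserving_orbit
    (hT : ∀ n, 1 ≤ n → Measure.QuasiMeasurePreserving (T n) volume volume) (l : ℕ) :
    Measure.QuasiMeasurePreserving (orbit T l) volume volume := by
  induction l with
  | zero => exact .id volume
  | succ l ih => exact (hT (l + 1) l.succ_pos).comp ih

lemma transfer_orbit_add (hT : ∀ n, 1 ≤ n → Measure.QuasiMeasurePreserving (T n) volume volume)
    (hf : Integrable f volume) (j l : ℕ) :
    transfer (orbit T (j + l)) f =ᵐ[volume]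
      transfer (orbit (fun i => T (j + i)) l) (transfer (orbit T j) f) := by
  rw [orbit_add]
  exact transfer_comp (quasiMeasurePreserving_orbit (fun n hn => hT _ (by omega)) l)
    (quasiMeasurePreserving_orbit hT j) hf

lemma transferProd_ae_eq_transfer_orbit
    (hT : ∀ n, 1 ≤ n → Measure.QuasiMeasurePreserving (T n) volume volume)
    (hf : Integrable f volume) (l : ℕ) :
    transferProd T l f =ᵐ[volume] transfer (orbit T l) f := by
  induction l with
  | zero => exact (transfer_id hf).symm
  | succ l ih =>
    have hT' := hT (l + 1) l.succ_pos
    exact (transfer_congr_ae hT' (integrable_transfer _ _) ih).trans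
      (transfer_comp hT' (quasiMeasurePreserving_orbit hT l) hf).symm

end Orbit

section BV

variable {f g h : I → ℝ}

lemma eVariationOn_sub_le {α E : Type*} [LinearOrder α] [SeminormedAddCommGroup E] (f g : α → E)
    (s : Set α) : eVariationOn (f - g) s ≤ eVariationOn f s + eVariationOn g s := by
  refine iSup_le fun ⟨n, u, hu, hus⟩ => ?_
  calc ∑ i ∈ Finset.range n, edist ((f - g) (u (i + 1))) ((f - g) (u i))
      ≤ ∑ i ∈ Finset.range n,
          (edist (f (u (i + 1))) (f (u i)) + edist (g (u (i + 1))) (g (u i))) :=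
        Finset.sum_le_sum fun i _ => by
          simp only [edist_eq_enorm_sub, Pi.sub_apply, sub_sub_sub_comm (f _) (g _)]
          exact enorm_sub_le
    _ ≤ _ := by
      rw [Finset.sum_add_distrib]
      exact add_le_add (eVariationOn.sum_le hu hus)
        (eVariationOn.sum_le hu hus)

lemma essVar_le_of_ae_eq (h : f =ᵐ[volume] g) : essVar f ≤ eVariationOn g Set.univ :=
  iInf₂_le g h

lemma bvNorm_eq_iInf (f : I → ℝ) :
    bvNorm f = ⨅ g : {g : I → ℝ // f =ᵐ[volume] g},
      (eVariationOn g.1 Set.univ + eLpNorm f 1 volume) := by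
  rw [bvNorm, essVar, iInf_subtype', ENNReal.iInf_add]

lemma bvNorm_congr_ae (h : f =ᵐ[volume] g) : bvNorm f = bvNorm g := by
  have hrep : ∀ u : I → ℝ, f =ᵐ[volume] u ↔ g =ᵐ[volume] u := fun u =>
    ⟨h.symm.trans, h.trans⟩
  simp only [bvNorm, essVar, hrep, eLpNorm_congr_ae h]

lemma memBV_of_bvNorm_lt_top (hf : Integrable f volume) (h : bvNorm f < ⊤) : MemBV f :=
  ⟨hf, le_self_add.trans_lt h⟩

lemma enorm_le_eVariationOn_add_eLpNorm (h : f =ᵐ[volume] g) (x : I) :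
    ‖g x‖ₑ ≤ eVariationOn g Set.univ + eLpNorm f 1 volume := by
  have hpt : ∀ y, ‖g x‖ₑ ≤ eVariationOn g Set.univ + ‖g y‖ₑ := fun y => by
    calc ‖g x‖ₑ ≤ ‖g x - g y‖ₑ + ‖g y‖ₑ := by simpa using enorm_add_le (g x - g y) (g y)
      _ ≤ _ := by
        gcongr
        rw [← edist_eq_enorm_sub]
        exact eVariationOn.edist_le _ (Set.mem_univ _) (Set.mem_univ _)
  calc ‖g x‖ₑ = ∫⁻ _ : I, ‖g x‖ₑ := by simp
    _ ≤ ∫⁻ y : I, (eVariationOn g Set.univ + ‖g y‖ₑ) := lintegral_mono hpt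
    _ = _ := by
      rw [lintegral_add_left measurable_const, eLpNorm_congr_ae h, eLpNorm_one_eq_lintegral_enorm]
      simp

lemma eLpNorm_top_le_bvNorm (f : I → ℝ) : eLpNorm f ⊤ volume ≤ bvNorm f := by
  rw [bvNorm_eq_iInf]
  refine le_iInf fun ⟨g, hg⟩ => ?_
  rw [eLpNorm_congr_ae hg, eLpNorm_exponent_top]
  refine eLpNormEssSup_le_of_ae_enorm_bound (.of_forall fun x => ?_)
  exact enorm_le_eVariationOn_add_eLpNorm hg x

lemma ae_abs_le_of_bvNorm_le {B : ℝ≥0} (h : bvNorm f ≤ B) : ∀ᵐ x, |f x| ≤ B := by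
  filter_upwards [enorm_ae_le_eLpNormEssSup f volume] with x hx
  rw [← Real.norm_eq_abs, ← coe_nnnorm, NNReal.coe_le_coe, ← ENNReal.coe_le_coe]
  exact hx.trans ((eLpNorm_top_le_bvNorm f).trans h)

lemma bvNorm_sub_le (hf : Integrable f volume) (hg : Integrable g volume) :
    bvNorm (f - g) ≤ bvNorm f + bvNorm g := by
  rw [bvNorm_eq_iInf f, bvNorm_eq_iInf g]
  refine ENNReal.le_iInf_add_iInf fun ⟨u, hu⟩ ⟨w, hw⟩ => ?_
  calc bvNorm (f - g)
      ≤ (eVariationOn u Set.univ + eVariationOn w Set.univ) +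
          (eLpNorm f 1 volume + eLpNorm g 1 volume) :=
        add_le_add ((essVar_le_of_ae_eq (hu.sub hw)).trans (eVariationOn_sub_le u w _))
          (eLpNorm_sub_le hf.1 hg.1 le_rfl)
    _ = _ := add_add_add_comm _ _ _ _

lemma bvNorm_mul_le {a b : ℝ≥0} (hfa : ∀ x, ‖f x‖ₑ ≤ a) (hfb : eVariationOn f Set.univ ≤ b)
    (h : I → ℝ) : bvNorm (f * h) ≤ (a + b) * bvNorm h := by
  rw [bvNorm_eq_iInf h, ENNReal.mul_iInf' (fun htop => by simp at htop) fun _ => ⟨h, .rfl⟩]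
  refine le_iInf fun ⟨g, hg⟩ => ?_
  have hvar : essVar (f * h) ≤
      a * eVariationOn g Set.univ + (eVariationOn g Set.univ + eLpNorm h 1 volume) * b :=
    (essVar_le_of_ae_eq (Filter.EventuallyEq.rfl.mul hg)).trans <|
      (eVariation_mul_le (fun x _ => hfa x)
        fun x _ => enorm_le_eVariationOn_add_eLpNorm hg x).trans (by gcongr)
  have hL1 : eLpNorm (f * h) 1 volume ≤ a * eLpNorm h 1 volume := by
    simp only [eLpNorm_one_eq_lintegral_enorm]
    rw [← lintegral_const_mul' _ _ ENNReal.coe_ne_top]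
    refine lintegral_mono fun x => ?_
    rw [Pi.mul_apply, enorm_mul]
    gcongr
    exact hfa x
  calc bvNorm (f * h) ≤ _ := add_le_add hvar hL1
    _ = _ := by ring

lemma bvNorm_one_le : bvNorm (fun _ => 1) ≤ 1 := by
  have hvar : essVar (fun _ : I => (1 : ℝ)) ≤ 0 :=
    (essVar_le_of_ae_eq .rfl).trans (eVariationOn.constant_on
      (Set.subsingleton_singleton.anti (Set.image_subset_iff.2 fun _ _ => rfl))).le
  have hL1 : eLpNorm (fun _ : I => (1 : ℝ)) 1 volume = 1 := by
    simp [eLpNorm_one_eq_lintegral_enorm]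
  calc bvNorm (fun _ : I => (1 : ℝ)) ≤ 0 + 1 := add_le_add hvar hL1.le
    _ = 1 := zero_add 1

lemma eVariationOn_indicator_Iic_sub_const_le {α : Type*} [LinearOrder α] (s : α) (c : ℝ) :
    eVariationOn (fun x => (Set.Iic s).indicator (1 : α → ℝ) x - c) Set.univ ≤ 1 := by
  have hanti : Antitone ((Set.Iic s).indicator (1 : α → ℝ)) := fun x y hxy => by
    by_cases hy : y ≤ s
    · simp [hy, hxy.trans hy]
    · by_cases hx : x ≤ s <;> simp [hx, hy]
  have hmaps : Set.MapsTo ((Set.Iic s).indicator (1 : α → ℝ)) Set.univ {0, 1} := fun x _ =>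
    Set.indicator_eq_zero_or_self (Set.Iic s) 1 x
  calc eVariationOn (fun x => (Set.Iic s).indicator (1 : α → ℝ) x - c) Set.univ
      ≤ eVariationOn (fun y : ℝ => y - c) {0, 1} :=
        eVariationOn.comp_le_of_antitoneOn (fun y : ℝ => y - c) _ (hanti.antitoneOn _) hmaps
    _ ≤ 1 := by simp [eVariationOn.pair, edist_dist]

end BV

section Decay

variable {T : ℕ → I → I} {θ K M : ℝ≥0}

/-- Condition (Dec) for the single sequence `(T_n)`, uniformly in the starting time `j`. -/
def BVDecay (T : ℕ → I → I) (θ K : ℝ≥0) : Prop :=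
  ∀ (j l : ℕ) (f : I → ℝ), MemBV f → ∫ x, f x = 0 →
    bvNorm (transfer (orbit (fun i => T (j + i)) l) f) ≤ (K * θ ^ l : ℝ≥0) * bvNorm f

lemma ConditionDec.exists_bvDecay {𝒞 : Set (I → I)} (h : ConditionDec 𝒞)
    (hq : ∀ S ∈ 𝒞, Measure.QuasiMeasurePreserving S volume volume) (hT : ∀ n, 1 ≤ n → T n ∈ 𝒞) :
    ∃ θ < 1, ∃ K, BVDecay T θ K := by
  obtain ⟨θ, K, hθ, hθ1, hK, hdec⟩ := h
  lift θ to ℝ≥0 using hθ.le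
  lift K to ℝ≥0 using hK.le
  refine ⟨θ, mod_cast hθ1, max 1 K, fun j l f hf hf0 => ?_⟩
  rcases Nat.eq_zero_or_pos l with rfl | hl
  · rw [orbit, bvNorm_congr_ae (transfer_id hf.1), pow_zero, mul_one]
    exact le_mul_of_one_le_left' (mod_cast le_max_left 1 K)
  · have hS : ∀ i, 1 ≤ i → T (j + i) ∈ 𝒞 := fun i hi => hT _ (by omega)
    rw [← bvNorm_congr_ae (transferProd_ae_eq_transfer_orbit (fun i hi => hq _ (hS i hi)) hf.1 l)]
    refine (hdec l hl _ (fun i hi _ => hS i hi) f hf hf0).trans ?_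
    rw [← NNReal.coe_pow, ← NNReal.coe_mul, ENNReal.ofReal_coe_nnreal]
    gcongr
    exact le_max_right 1 K

lemma ConditionD.exists_bvNorm_transfer_one_le {r : ℕ} {𝒞 : Set (I → I)} (h : ConditionD r 𝒞) :
    ∃ M : ℝ≥0, ∀ S ∈ 𝒞, bvNorm (transfer S fun _ => 1) ≤ M := by
  obtain ⟨-, M, -, -, -, -, -, hM, -⟩ := h
  have hone : MemBV fun _ => 1 :=
    memBV_of_bvNorm_lt_top (integrable_const 1) (bvNorm_one_le.trans_lt ENNReal.one_lt_top)
  exact ⟨M.toNNReal, fun S hS => (hM S hS _ hone).trans (mul_le_of_le_one_right' bvNorm_one_le)⟩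

lemma sum_range_pow_le_inv_one_sub (hθ : θ < 1) (n : ℕ) :
    ∑ l ∈ Finset.range n, θ ^ l ≤ (1 - θ)⁻¹ :=
  ((NNReal.summable_geometric hθ).sum_le_tsum _ fun _ _ => zero_le).trans_eq
    (NNReal.tsum_geometric hθ)

lemma sum_range_pow_sub_le_inv_one_sub (hθ : θ < 1) (n : ℕ) :
    ∑ k ∈ Finset.range n, θ ^ (n - k) ≤ (1 - θ)⁻¹ :=
  calc ∑ k ∈ Finset.range n, θ ^ (n - k)
      ≤ ∑ k ∈ Finset.range n, θ ^ (n - 1 - k) :=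
        Finset.sum_le_sum fun k _ => pow_le_pow_of_le_one zero_le hθ.le (by omega)
    _ = ∑ l ∈ Finset.range n, θ ^ l := Finset.sum_range_reflect _ n
    _ ≤ (1 - θ)⁻¹ := sum_range_pow_le_inv_one_sub hθ n

lemma BVDecay.bvNorm_transfer_orbit_le_add (hdec : BVDecay T θ K)
    (hT : ∀ n, 1 ≤ n → Measure.QuasiMeasurePreserving (T n) volume volume) {f g : I → ℝ}
    (hf : Integrable f volume) (hg : Integrable g volume) (hgf : MemBV (g - f))
    (heq : ∫ x, f x = ∫ x, g x) (j n : ℕ) :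
    bvNorm (transfer (orbit (fun i => T (j + i)) n) f) ≤
      bvNorm (transfer (orbit (fun i => T (j + i)) n) g) + (K * θ ^ n : ℝ≥0) * bvNorm (g - f) := by
  set Q := orbit (fun i => T (j + i)) n
  have hQ : Measure.QuasiMeasurePreserving Q volume volume :=
    quasiMeasurePreserving_orbit (fun i _ => hT _ (by omega)) n
  have hsplit : transfer Q f =ᵐ[volume] transfer Q g - transfer Q (g - f) := by
    filter_upwards [transfer_sub hQ hg hf] with x hx
    rw [Pi.sub_apply, hx, Pi.sub_apply, sub_sub_cancel]
  have hmean : ∫ x, (g - f) x = 0 := by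
    simp only [Pi.sub_apply]
    rw [integral_sub hg hf, heq, sub_self]
  rw [bvNorm_congr_ae hsplit]
  exact (bvNorm_sub_le (integrable_transfer _ _) (integrable_transfer _ _)).trans
    (add_le_add_right (hdec j n _ hgf hmean) _)

lemma BVDecay.bvNorm_transfer_orbit_succ_one_le (hdec : BVDecay T θ K)
    (hT : ∀ n, 1 ≤ n → Measure.QuasiMeasurePreserving (T n) volume volume)
    (hM : ∀ n, 1 ≤ n → bvNorm (transfer (T n) fun _ => 1) ≤ M) (j n : ℕ) :
    bvNorm (transfer (orbit (fun i => T (j + i)) (n + 1)) fun _ => 1) ≤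
      bvNorm (transfer (orbit (fun i => T (j + 1 + i)) n) fun _ => 1) +
        (K * (1 + M) * θ ^ n : ℝ≥0) := by
  set one : I → ℝ := fun _ => 1
  have hone : Integrable one volume := integrable_const 1
  have hp : Integrable (transfer (T (j + 1)) one) volume := integrable_transfer _ _
  have horbit : orbit (fun i => T (j + i)) (n + 1) =
      orbit (fun i => T (j + 1 + i)) n ∘ T (j + 1) := by
    rw [add_comm n 1, orbit_add]
    simp only [← add_assoc]
    rfl
  have hdiff : bvNorm (one - transfer (T (j + 1)) one) ≤ (1 + M : ℝ≥0) :=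
    (bvNorm_sub_le hone hp).trans (add_le_add bvNorm_one_le (hM _ (by omega)))
  rw [horbit, bvNorm_congr_ae (transfer_comp
    (quasiMeasurePreserving_orbit (fun i _ => hT _ (by omega)) n) (hT _ (by omega)) hone)]
  refine (hdec.bvNorm_transfer_orbit_le_add hT hp hone (memBV_of_bvNorm_lt_top (hone.sub hp)
    (hdiff.trans_lt ENNReal.coe_lt_top)) (integral_transfer (hT _ (by omega)) hone)
    (j + 1) n).trans ?_
  rw [mul_right_comm, ENNReal.coe_mul _ (1 + M)]
  gcongr

lemma BVDecay.exists_bvNorm_transfer_orbit_one_le (hdec : BVDecay T θ K) (hθ : θ < 1)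
    (hT : ∀ n, 1 ≤ n → Measure.QuasiMeasurePreserving (T n) volume volume)
    (hM : ∀ n, 1 ≤ n → bvNorm (transfer (T n) fun _ => 1) ≤ M) :
    ∃ B : ℝ≥0, ∀ n, bvNorm (transfer (orbit T n) fun _ => 1) ≤ B := by
  have hsum : ∀ n j, bvNorm (transfer (orbit (fun i => T (j + i)) n) fun _ => 1) ≤
      (1 + K * (1 + M) * ∑ l ∈ Finset.range n, θ ^ l : ℝ≥0) := fun n => by
    induction n with
    | zero =>
      intro j
      rw [orbit, bvNorm_congr_ae (transfer_id (integrable_const 1))]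
      simpa using bvNorm_one_le
    | succ n ih =>
      intro j
      refine (hdec.bvNorm_transfer_orbit_succ_one_le hT hM j n).trans
        ((add_le_add_left (ih (j + 1)) _).trans_eq ?_)
      rw [← ENNReal.coe_add, Finset.sum_range_succ]
      ring_nf
  refine ⟨1 + K * (1 + M) * (1 - θ)⁻¹, fun n => ?_⟩
  simpa only [zero_add] using (hsum n 0).trans (by gcongr; exact sum_range_pow_le_inv_one_sub hθ n)

lemma ConditionDec.exists_bvNorm_transfer_orbit_one_le {𝒞 : Set (I → I)} {r : ℕ}
    (hDec : ConditionDec 𝒞) (hD : ConditionD r 𝒞)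
    (hq : ∀ S ∈ 𝒞, Measure.QuasiMeasurePreserving S volume volume) (hT : ∀ n, 1 ≤ n → T n ∈ 𝒞) :
    ∃ B : ℝ≥0, ∀ n, bvNorm (transfer (orbit T n) fun _ => 1) ≤ B := by
  obtain ⟨θ, hθ, K, hdec⟩ := hDec.exists_bvDecay hq hT
  obtain ⟨M, hM⟩ := hD.exists_bvNorm_transfer_one_le
  exact hdec.exists_bvNorm_transfer_orbit_one_le hθ (fun n hn => hq _ (hT n hn))
    fun n hn => hM _ (hT n hn)

end Decay

section CenteredIndicator

lemma abs_indicator_one_sub_le_one {α : Type*} (B : Set α) {c : ℝ} (h0 : 0 ≤ c) (h1 : c ≤ 1)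
    (x : α) : |B.indicator (1 : α → ℝ) x - c| ≤ 1 := by
  by_cases hx : x ∈ B
  · rw [Set.indicator_of_mem hx, Pi.one_apply, abs_le]
    constructor <;> linarith
  · rw [Set.indicator_of_notMem hx, zero_sub, abs_neg, abs_of_nonneg h0]
    exact h1

/-- The indicator of `B` minus its mean `μ B`. For `B = (T_1^k)⁻¹ A` this is the deviation of the
visit of the orbit to `A` at time `k` from its expectation. -/
noncomputable def centeredIndicator {Ω : Type*} [MeasurableSpace Ω] (μ : Measure Ω) (B : Set Ω) :
    Ω → ℝ :=
  fun x => B.indicator 1 x - μ.real B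

section Probability

variable {Ω : Type*} {m mΩ : MeasurableSpace Ω} {μ : Measure Ω} {B : Set Ω}

lemma measurable_centeredIndicator (hB : MeasurableSet[m] B) :
    Measurable[m] (centeredIndicator μ B) :=
  ((@measurable_const _ _ _ m 1).indicator hB).sub_const _

lemma abs_centeredIndicator_le_one [IsProbabilityMeasure μ] (x : Ω) :
    |centeredIndicator μ B x| ≤ 1 :=
  abs_indicator_one_sub_le_one B measureReal_nonneg measureReal_le_one x

lemma integrable_centeredIndicator [IsFiniteMeasure μ] (hB : MeasurableSet B) :
    Integrable (centeredIndicator μ B) μ :=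
  ((integrable_const 1).indicator hB).sub (integrable_const _)

lemma integral_centeredIndicator [IsProbabilityMeasure μ] (hB : MeasurableSet B) :
    ∫ x, centeredIndicator μ B x ∂μ = 0 := by
  simp only [centeredIndicator]
  rw [integral_sub ((integrable_const 1).indicator hB) (integrable_const _),
    integral_indicator_one hB, integral_const, probReal_univ, one_smul, sub_self]

end Probability

variable {T : ℕ → I → I} {θ K B : ℝ≥0}

lemma bvNorm_transfer_centeredIndicator_preimage_Iic_le {S : I → I}
    (hS : Measure.QuasiMeasurePreserving S volume volume) (s : I) :
    bvNorm (transfer S (centeredIndicator volume (S ⁻¹' Set.Iic s))) ≤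
      2 * bvNorm (transfer S fun _ => 1) := by
  set c := volume.real (S ⁻¹' Set.Iic s)
  have habs : ∀ x, ‖(Set.Iic s).indicator (1 : I → ℝ) x - c‖ₑ ≤ (1 : ℝ≥0) := fun x => by
    rw [← ofReal_norm, ENNReal.coe_one, ENNReal.ofReal_le_one]
    exact abs_indicator_one_sub_le_one _ measureReal_nonneg measureReal_le_one x
  refine (bvNorm_congr_ae
    (transfer_indicator_preimage_sub_const hS measurableSet_Iic c)).trans_le ?_
  rw [← one_add_one_eq_two]
  exact bvNorm_mul_le habs (eVariationOn_indicator_Iic_sub_const_le s c) _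

lemma BVDecay.bvNorm_transfer_orbit_add_centeredIndicator_le (hdec : BVDecay T θ K)
    (hT : ∀ n, 1 ≤ n → Measure.QuasiMeasurePreserving (T n) volume volume) {j : ℕ}
    (hB : bvNorm (transfer (orbit T j) fun _ => 1) ≤ B) (l : ℕ) (s : I) :
    bvNorm (transfer (orbit T (j + l)) (centeredIndicator volume (orbit T j ⁻¹' Set.Iic s))) ≤
      (K * (2 * B) * θ ^ l : ℝ≥0) := by
  have hj := quasiMeasurePreserving_orbit hT j
  have hs : MeasurableSet (orbit T j ⁻¹' Set.Iic s) := hj.measurable measurableSet_Iic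
  have hvisit := integrable_centeredIndicator (μ := volume) hs
  set f := transfer (orbit T j) (centeredIndicator volume (orbit T j ⁻¹' Set.Iic s))
  have hf : bvNorm f ≤ (2 * B : ℝ≥0) :=
    (bvNorm_transfer_centeredIndicator_preimage_Iic_le hj s).trans (by push_cast; gcongr)
  have hmem : MemBV f :=
    memBV_of_bvNorm_lt_top (integrable_transfer _ _) (hf.trans_lt ENNReal.coe_lt_top)
  have hmean : ∫ x, f x = 0 := by
    rw [integral_transfer hj hvisit, integral_centeredIndicator hs]
  rw [bvNorm_congr_ae (transfer_orbit_add hT hvisit j l), mul_right_comm, ENNReal.coe_mul]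
  exact (hdec j l f hmem hmean).trans (by gcongr)

end CenteredIndicator

section Discrepancy

variable {T : ℕ → I → I} {θ K B : ℝ≥0}

/-- The unnormalised discrepancy at `s` of the first `n` points of an orbit: `n` times the value at
`s` of `F_{ℰ_n(x)} - F_{m_n}`. -/
noncomputable def discrepancy (T : ℕ → I → I) (n : ℕ) (s : I) : I → ℝ :=
  ∑ k ∈ Finset.range n, centeredIndicator volume (orbit T k ⁻¹' Set.Iic s)

lemma abs_discrepancy_le (T : ℕ → I → I) (n : ℕ) (s x : I) : |discrepancy T n s x| ≤ n := by
  rw [discrepancy, Finset.sum_apply]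
  calc |∑ k ∈ Finset.range n, centeredIndicator volume (orbit T k ⁻¹' Set.Iic s) x|
      ≤ ∑ _k ∈ Finset.range n, (1 : ℝ) := (Finset.abs_sum_le_sum_abs _ _).trans
        (Finset.sum_le_sum fun k _ => abs_centeredIndicator_le_one x)
    _ = n := by simp

lemma integrable_discrepancy (hT : ∀ k, Measurable (orbit T k)) (n : ℕ) (s : I) :
    Integrable (discrepancy T n s) volume :=
  integrable_finsetSum' _ fun k _ => integrable_centeredIndicator (hT k measurableSet_Iic)

lemma measurable_uncurry_discrepancy (hT : ∀ k, Measurable (orbit T k)) (n : ℕ) :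
    Measurable (Function.uncurry fun x s => discrepancy T n s x) := by
  simp only [discrepancy, Finset.sum_apply, Function.uncurry_def]
  refine Finset.measurable_fun_sum _ fun k _ => ?_
  have hvisit : MeasurableSet {z : I × I | orbit T k z.1 ≤ z.2} :=
    measurableSet_le ((hT k).comp measurable_fst) measurable_snd
  have hmono : Monotone fun s : I => volume.real (orbit T k ⁻¹' Set.Iic s) :=
    fun a b hab => measureReal_mono (Set.preimage_mono (Set.Iic_subset_Iic.2 hab))
  exact ((measurable_one (α := ℝ)).indicator hvisit).sub (hmono.measurable.comp measurable_snd)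

lemma BVDecay.abs_transfer_orbit_discrepancy_le (hdec : BVDecay T θ K) (hθ : θ < 1)
    (hT : ∀ n, 1 ≤ n → Measure.QuasiMeasurePreserving (T n) volume volume)
    (hB : ∀ n, bvNorm (transfer (orbit T n) fun _ => 1) ≤ B) (n : ℕ) (s : I) :
    ∀ᵐ x, |transfer (orbit T n) (discrepancy T n s) x| ≤ (K * (2 * B) * (1 - θ)⁻¹ : ℝ≥0) := by
  set φ := fun k => centeredIndicator volume (orbit T k ⁻¹' Set.Iic s)
  have horbit := quasiMeasurePreserving_orbit hT
  have hφ : ∀ k ∈ Finset.range n, Integrable (φ k) volume := fun k _ =>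
    integrable_centeredIndicator ((horbit k).measurable measurableSet_Iic)
  have hterm : ∀ k ∈ Finset.range n, ∀ᵐ x,
      |transfer (orbit T n) (φ k) x| ≤ (K * (2 * B) * θ ^ (n - k) : ℝ≥0) := fun k hk => by
    have h := hdec.bvNorm_transfer_orbit_add_centeredIndicator_le hT (hB k) (n - k) s
    rw [Nat.add_sub_of_le (Finset.mem_range.1 hk).le] at h
    exact ae_abs_le_of_bvNorm_le h
  filter_upwards [transfer_finsetSum (horbit n) (Finset.range n) hφ,
    (Finset.eventually_all _).2 hterm] with x hsum hx
  rw [discrepancy, hsum, Finset.sum_apply]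
  calc |∑ k ∈ Finset.range n, transfer (orbit T n) (φ k) x|
      ≤ ∑ k ∈ Finset.range n, ((K * (2 * B) * θ ^ (n - k) : ℝ≥0) : ℝ) :=
        (Finset.abs_sum_le_sum_abs _ _).trans (Finset.sum_le_sum hx)
    _ ≤ _ := by
      rw [← NNReal.coe_sum, NNReal.coe_le_coe, ← Finset.mul_sum]
      gcongr
      exact sum_range_pow_sub_le_inv_one_sub hθ n

lemma exists_abs_condExp_discrepancy_le
    (hT : ∀ n, 1 ≤ n → Measure.QuasiMeasurePreserving (T n) volume volume)
    (hbd : ∃ B : ℝ≥0, ∀ n, bvNorm (transfer (orbit T n) fun _ => 1) ≤ B)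
    (hdec : ∃ θ < 1, ∃ K, BVDecay T θ K) (hMin : ConditionMin T) :
    ∃ L : ℝ≥0, ∀ n s, ∀ᵐ x,
      |(volume[discrepancy T n s | MeasurableSpace.comap (orbit T n) inferInstance]) x| ≤ L := by
  obtain ⟨B, hB⟩ := hbd
  obtain ⟨θ, hθ, K, hdec⟩ := hdec
  obtain ⟨δ, hδ, hmin⟩ := hMin
  have horbit := quasiMeasurePreserving_orbit hT
  lift δ to ℝ≥0 using hδ.le
  refine ⟨K * (2 * B) * (1 - θ)⁻¹ / δ, fun n s => ?_⟩
  rcases Nat.eq_zero_or_pos n with rfl | hn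
  · have hzero : discrepancy T 0 s = 0 := rfl
    filter_upwards with x
    rw [hzero, condExp_zero, Pi.zero_apply, abs_zero]
    exact NNReal.coe_nonneg _
  refine abs_condExp_comap_le_of_abs_transfer_le (horbit n)
    (integrable_discrepancy (fun k => (horbit k).measurable) n s) ?_
  filter_upwards [hdec.abs_transfer_orbit_discrepancy_le hθ hT hB n s, hmin n hn] with x hx hxδ
  rw [NNReal.coe_div, div_mul_eq_mul_div, le_div_iff₀ hδ]
  gcongr

open ProbabilityTheory in
lemma mgf_discrepancy_le
    (hT : ∀ n, 1 ≤ n → Measure.QuasiMeasurePreserving (T n) volume volume) {L : ℝ≥0} {s : I}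
    (hL : ∀ n, ∀ᵐ x,
      |(volume[discrepancy T n s | MeasurableSpace.comap (orbit T n) inferInstance]) x| ≤ L)
    (n : ℕ) (t : ℝ) :
    mgf (discrepancy T n s) volume t ≤
      Real.exp (|t| * L) * Real.exp (n * (1 + 2 * L) ^ 2 * t ^ 2 / 2) := by
  have horbit := quasiMeasurePreserving_orbit hT
  exact mgf_sum_le_of_abs_condExp_le (b := 1)
    (antitone_comap_orbit fun n hn => (hT n hn).measurable)
    (fun k => (horbit k).measurable.comap_le)
    (fun k => measurable_centeredIndicator ⟨Set.Iic s, measurableSet_Iic, rfl⟩)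
    (fun k => .of_forall abs_centeredIndicator_le_one) hL n t

open ProbabilityTheory in
lemma mgf_integral_abs_discrepancy_le
    (hT : ∀ n, 1 ≤ n → Measure.QuasiMeasurePreserving (T n) volume volume) {L : ℝ≥0}
    (hL : ∀ s n, ∀ᵐ x,
      |(volume[discrepancy T n s | MeasurableSpace.comap (orbit T n) inferInstance]) x| ≤ L)
    (n : ℕ) {t : ℝ} (ht : 0 ≤ t) :
    mgf (fun x => ∫ s, |discrepancy T n s x|) volume t ≤
      2 * (Real.exp (t * L) * Real.exp (n * (1 + 2 * L) ^ 2 * t ^ 2 / 2)) := by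
  have hpos : ∀ s, _ := fun s => mgf_discrepancy_le hT (hL s) n t
  have hneg : ∀ s, _ := fun s => mgf_discrepancy_le hT (hL s) n (-t)
  simp only [abs_neg, neg_sq, abs_of_nonneg ht] at hpos hneg
  exact mgf_integral_abs_le
    (measurable_uncurry_discrepancy (fun k => (quasiMeasurePreserving_orbit hT k).measurable) n)
    (fun x s => abs_discrepancy_le T n s x) hpos hneg

lemma integrable_exp_mul_integral_abs_discrepancy (hT : ∀ k, Measurable (orbit T k)) (n : ℕ)
    (t : ℝ) : Integrable (fun x => Real.exp (t * ∫ s, |discrepancy T n s x|)) volume := by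
  have hmeas : StronglyMeasurable fun x => ∫ s, |discrepancy T n s x| :=
    (measurable_uncurry_discrepancy hT n).abs.stronglyMeasurable.integral_prod_right
  have hbound : ∀ x, ∫ s, |discrepancy T n s x| ∈ Set.Icc (0 : ℝ) n := fun x =>
    ⟨integral_nonneg fun s => abs_nonneg _, (integral_mono_of_nonneg
      (.of_forall fun s => abs_nonneg _) (integrable_const (n : ℝ))
      (.of_forall fun s => abs_discrepancy_le T n s x)).trans_eq (by simp)⟩
  exact ProbabilityTheory.integrable_exp_mul_of_mem_Icc hmeas.measurable.aemeasurable
    (.of_forall hbound)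

lemma inv_smul_sum_real_apply {Ω : Type*} [MeasurableSpace Ω] (n : ℕ) (ν : ℕ → Measure Ω)
    [∀ k, IsFiniteMeasure (ν k)] (A : Set Ω) :
    ((n : ENNReal)⁻¹ • ∑ k ∈ Finset.range n, ν k).real A =
      (n : ℝ)⁻¹ * ∑ k ∈ Finset.range n, (ν k).real A := by
  rw [measureReal_ennreal_smul_apply, ENNReal.toReal_inv, ENNReal.toReal_natCast, Measure.real,
    Measure.finsetSum_apply, ENNReal.toReal_sum fun k _ => measure_ne_top (ν k) A]
  rfl

lemma empiricalMeasure_real_Iic (T : ℕ → I → I) (n : ℕ) (x s : I) :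
    (empiricalMeasure T n x).real (Set.Iic s) =
      (n : ℝ)⁻¹ * ∑ k ∈ Finset.range n, (orbit T k ⁻¹' Set.Iic s).indicator 1 x := by
  rw [empiricalMeasure, inv_smul_sum_real_apply]
  congr with k
  by_cases h : orbit T k x ≤ s <;> simp [Measure.real, h]

lemma meanMeasure_real_Iic (hT : ∀ k, Measurable (orbit T k)) (n : ℕ) (s : I) :
    (meanMeasure T n).real (Set.Iic s) =
      (n : ℝ)⁻¹ * ∑ k ∈ Finset.range n, volume.real (orbit T k ⁻¹' Set.Iic s) := by
  rw [meanMeasure, inv_smul_sum_real_apply]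
  congr with k
  exact map_measureReal_apply (hT k) measurableSet_Iic

lemma kantorovich_empiricalMeasure_meanMeasure (hT : ∀ k, Measurable (orbit T k)) (n : ℕ) (x : I) :
    kantorovich (empiricalMeasure T n x) (meanMeasure T n) =
      (n : ℝ)⁻¹ * ∫ s, |discrepancy T n s x| := by
  rw [kantorovich, ← integral_const_mul]
  congr with s
  rw [empiricalMeasure_real_Iic, meanMeasure_real_Iic hT, ← mul_sub, ← Finset.sum_sub_distrib,
    abs_mul, abs_of_nonneg (by positivity), discrepancy, Finset.sum_apply]
  rfl

lemma div_sqrt_lt_kantorovich_iff (hT : ∀ k, Measurable (orbit T k)) {n : ℕ} (hn : 1 ≤ n) {t : ℝ}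
    {x : I} : t / √n < kantorovich (empiricalMeasure T n x) (meanMeasure T n) ↔
      √n * t < ∫ s, |discrepancy T n s x| := by
  have hn0 : (0 : ℝ) < n := by exact_mod_cast hn
  rw [kantorovich_empiricalMeasure_meanMeasure hT, ← div_eq_inv_mul, lt_div_iff₀ hn0,
    div_mul_eq_mul_div, mul_div_assoc, Real.div_sqrt, mul_comm]

end Discrepancy

end SeqDyn

open SeqDyn in
theorem mainTheorem4_general {T : ℕ → I → I}
    (hT : ∀ n, 1 ≤ n → Measure.QuasiMeasurePreserving (T n) volume volume)
    (hbd : ∃ B : NNReal, ∀ n, bvNorm (transfer (orbit T n) fun _ => 1) ≤ B)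
    (hdec : ∃ θ < 1, ∃ K, BVDecay T θ K) (hMin : ConditionMin T) :
    ∃ t₀ C : ℝ, 0 < t₀ ∧ 0 < C ∧ ∀ t : ℝ, t₀ < t → ∀ n : ℕ, 1 ≤ n →
      volume {x : I | t / √n < kantorovich (empiricalMeasure T n x) (meanMeasure T n)} ≤
        ENNReal.ofReal (Real.exp (-C * t ^ 2)) := by
  have horbit : ∀ k, Measurable (orbit T k) := fun k =>
    (quasiMeasurePreserving_orbit hT k).measurable
  obtain ⟨L, hL⟩ := exists_abs_condExp_discrepancy_le hT hbd hdec hMin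
  set v : ℝ := (1 + 2 * L) ^ 2
  refine ⟨4 * (L + v) + 1, 1 / (4 * v), by positivity, by positivity, fun t ht n hn => ?_⟩
  have hmgf := fun u hu => mgf_integral_abs_discrepancy_le hT (fun s n => hL n s) n (t := u) hu
  have htail := measureReal_sqrt_mul_lt_le L.coe_nonneg (by positivity) hn
    (integrable_exp_mul_integral_abs_discrepancy horbit n) hmgf ht
  rw [ENNReal.le_ofReal_iff_toReal_le (measure_ne_top _ _) (by positivity)]
  simp only [div_sqrt_lt_kantorovich_iff horbit hn]
  exact htail.trans_eq (by rw [neg_mul, one_div_mul_eq_div])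

theorem mainTheorem4 (𝒞 : Set (unitInterval → unitInterval))
    (r : ℕ) (hr : 1 ≤ r) (hD : SeqDyn.ConditionD r 𝒞) (hDec : SeqDyn.ConditionDec 𝒞)
    (lam M : ℝ) (N : ℕ) (hlam : 1 < lam) (hM : 1 ≤ M) (hN : 1 ≤ N)
    (hexp : SeqDyn.UniformlyPiecewiseExpanding 𝒞 lam M N)
    (T : ℕ → unitInterval → unitInterval) (hT : ∀ n, 1 ≤ n → T n ∈ 𝒞)
    (hMin : SeqDyn.ConditionMin T) :
    ∃ t₀ C : ℝ, 0 < t₀ ∧ 0 < C ∧ ∀ t : ℝ, t₀ < t → ∀ n : ℕ, 1 ≤ n →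
      MeasureTheory.volume {x : unitInterval |
        t / Real.sqrt n <
          SeqDyn.kantorovich (SeqDyn.empiricalMeasure T n x) (SeqDyn.meanMeasure T n)} ≤
        ENNReal.ofReal (Real.exp (-C * t ^ 2)) :=
  have hq := hexp.quasiMeasurePreserving (zero_lt_one.trans hlam)
  mainTheorem4_general (fun n hn => hq _ (hT n hn))
    (hDec.exists_bvNorm_transfer_orbit_one_le hD hq hT) (hDec.exists_bvDecay hq hT) hMin
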